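/- Let $n\ge 1$, let $\mathbb F$ be a field, and let $V=\bigoplus_{m\in\mathbb Z/n}V_m$ be a finite-dimensional $\mathbb F$-vector space with a fixed decomposition into (possibly zero) subspaces. Write $[k]$ for the class of $k\in\mathbb Z$ in $\mathbb Z/n$. Let $K=\prod_m GL(V_m)\subset GL(V)$, and let $\mathcal N$ be the set of nilpotent $x\in\mathrm{End}(V)$ with $xV_m\subset V_{m+[1]}$ for all $m$. The group $K$ acts on $\mathcal N$ by conjugation and diagonally on $V\times\mathcal N$; write $\mathcal O_x$ and $\mathcal O_{v,x}$ for the orbits. A colored partition is a pair $(\lambda,\epsilon)$, where $\lambda=(\lambda_1\ge\lambda_2\ge\cdots)$ is a sequence of nonnegative integers that is eventually $0$, and $\epsilon:\{1,2,\dots\}\to\mathbb Z/n$ takes each value infinitely often. Its length $l(\lambda)$ is the number of $i$ with $\lambda_i>0$. Its signature assigns to $m\in\mathbb Z/n$ the number of pairs $(i,j)$ with $1\le j\le\lambda_i$ and $\epsilon_i+[\lambda_i-j]=m$; all colored partitions below are required to have signature $m\mapsto\dim V_m$. A colored Jordan basis of type $(\lambda,\epsilon)$ for $x\in\mathcal N$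 is a basis $\{v_{i,j}\mid 1\le j\le\lambda_i\}$ of $V$ with $v_{i,j}\in V_{\epsilon_i+[\lambda_i-j]}$, $xv_{i,j}=v_{i,j-1}$ for $j>1$, and $xv_{i,1}=0$. The $x\in\mathcal N$ that have such a basis form a single $K$-orbit $\mathcal O_{\lambda,\epsilon}$. A marking of $\lambda$ is a function $\mu:\{1,2,\dots\}\to\mathbb Z$ with $\mu_i\le\lambda_i$ for all $i$; markings are ordered pointwise. Put $\Psi(\lambda,\epsilon,\mu)=\mathcal O_{v,x}$, where $x\in\mathcal N$ has a colored Jordan basis $\{v_{i,j}\}$ of type $(\lambda,\epsilon)$ and $v=\sum_{i=1}^{l(\lambda)}v_{i,\mu_i}$ (with $v_{i,j}=0$ for $j\le 0$); this does not depend on the choices. The triples $(\lambda,\epsilon,\mu)$ and $(\alpha,\beta,\gamma)$ are row-equivalent if there is a permutation $\sigma$ of $\{1,2,\dots\}$ with $\alpha=\lambda\circ\sigma$, $\beta=\epsilon\circ\sigma$, $\gamma=\mu\circ\sigma$. **Theorem.** Let $\mathcal O\in K\backslash(V\times\mathcal N)$ be in the image of $\Psi$, and let $(\lambda,\epsilon)$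 be a corresponding colored partition, that is, $x\in\mathcal O_{\lambda,\epsilon}$ for $(v,x)\in\mathcal O$. Let $S_{\mathcal O}$ be the set of markings $\mu$ of $\lambda$ with $\mu\ge 0$ and $\Psi(\lambda,\epsilon,\mu)=\mathcal O$, and call $\mu\in S_{\mathcal O}$ minimal if $\delta\in S_{\mathcal O}$ and $\delta\le\mu$ imply $\delta=\mu$. Then: 1. There is a minimal $\mu\in S_{\mathcal O}$. 2. For each $\mu\in S_{\mathcal O}$ there is a minimal $\delta\in S_{\mathcal O}$ with $\delta\le\mu$. 3. If $\mu,\delta\in S_{\mathcal O}$ are both minimal, then $(\lambda,\epsilon,\mu)$ and $(\lambda,\epsilon,\delta)$ are row-equivalent. 4. An element $\mu\in S_{\mathcal O}$ is minimal if and only if $\mu_i>\mu_j$ and $\lambda_i-\mu_i>\lambda_j-\mu_j$ for every pair $i<j$ with $\mu_i>0$, $\mu_j>0$ and $\epsilon_j+[\lambda_j-\mu_j]=\epsilon_i+[\lambda_i-\mu_i]$. -/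

import Mathlib

namespace ColoredCone

/-! ### Colored partitions, markings, row equivalence -/

/-- An `n`-colored partition `(λ, ε)`.  Rows are indexed from `0` instead of `1`. -/
structure ColoredPartition (n : ℕ) where
  /-- row lengths `λ_i` -/
  len : ℕ → ℕ
  len_antitone : Antitone len
  exists_len_eq_zero : ∃ i, len i = 0
  /-- row colors `ε_i` -/
  color : ℕ → ZMod n
  infinite_color : ∀ m : ZMod n, {i | color i = m}.Infinite

namespace ColoredPartition

variable {n : ℕ} (P : ColoredPartition n)

/-- The length `l(λ)`: the number of nonzero rows. -/
noncomputable def length : ℕ := {i | 0 < P.len i}.ncard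

/-- The boxes `(i, j)`, `1 ≤ j ≤ λ_i`, of the Young diagram (columns are indexed from `1`). -/
abbrev Box : Type := {p : ℕ × ℕ // 1 ≤ p.2 ∧ p.2 ≤ P.len p.1}

/-- The color `ε_i + [λ_i - j]` of the box `(i, j)`. -/
def boxColor (p : P.Box) : ZMod n :=
  P.color p.1.1 + (((P.len p.1.1 : ℤ) - (p.1.2 : ℤ) : ℤ) : ZMod n)

/-- The signature `ξ(λ, ε)`: the number of boxes of each color. -/
noncomputable def signature (m : ZMod n) : ℕ := Nat.card {p : P.Box // P.boxColor p = m}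

/-- A marking of `λ`: a function `μ` with integer values and `μ_i ≤ λ_i` for each `i`.
Markings are ordered pointwise. -/
def Marking : Type := {μ : ℕ → ℤ // ∀ i, μ i ≤ (P.len i : ℤ)}

instance : PartialOrder P.Marking :=
  inferInstanceAs (PartialOrder {μ : ℕ → ℤ // ∀ i, μ i ≤ (P.len i : ℤ)})

instance : CoeFun P.Marking (fun _ => ℕ → ℤ) := ⟨fun μ => μ.1⟩

/-- The color `ε_i + [λ_i - μ_i]` attached to the mark in row `i`. -/
def markColor (μ : P.Marking) (i : ℕ) : ZMod n :=
  P.color i + (((P.len i : ℤ) - μ i : ℤ) : ZMod n)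

instance : Finite P.Box := by
  obtain ⟨N, hN⟩ := P.exists_len_eq_zero
  have hfin : ((Set.Iio N) ×ˢ (Set.Iic (P.len 0)) : Set (ℕ × ℕ)).Finite :=
    (Set.finite_Iio N).prod (Set.finite_Iic _)
  have hsub : {p : ℕ × ℕ | 1 ≤ p.2 ∧ p.2 ≤ P.len p.1} ⊆ (Set.Iio N) ×ˢ (Set.Iic (P.len 0)) := by
    rintro ⟨i, j⟩ ⟨h1, h2⟩
    have h3 : P.len i ≤ P.len 0 := P.len_antitone (Nat.zero_le i)
    refine ⟨?_, h2.trans h3⟩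
    by_contra hi
    have h4 : P.len i ≤ P.len N := P.len_antitone (not_lt.mp hi)
    dsimp only at h1 h2
    omega
  exact (hfin.subset hsub).to_subtype

end ColoredPartition

/-- Row equivalence of marked colored partitions `(λ, ε, μ)` and `(α, β, γ)`: one is obtained from
the other by permuting rows, together with their colors and marks. -/
def RowEquivalent {n : ℕ} (P Q : ColoredPartition n) (μ : P.Marking) (γ : Q.Marking) : Prop :=
  ∃ σ : Equiv.Perm ℕ, ∀ i, Q.len i = P.len (σ i) ∧ Q.color i = P.color (σ i) ∧ γ i = μ (σ i)

/-! ### Colored vector spaces, the group `K` and the colored nilpotent cone -/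

section Spaces

variable {n : ℕ} {F V : Type*} [Field F] [AddCommGroup V] [Module F V]
variable (C : ZMod n → Submodule F V)

/-- The signature `ξ(V)` of the colored space `V = ⨁ V_m`, where `V_m = C m`. -/
noncomputable def spaceSignature (m : ZMod n) : ℕ := Module.finrank F (C m)

/-- The group `K = ∏ GL(V_m)`, as the subgroup of `GL(V)` preserving each `V_m`. -/
def colorGroup : Subgroup (V ≃ₗ[F] V) where
  carrier := {g | ∀ m v, g v ∈ C m ↔ v ∈ C m}
  one_mem' := fun _ _ => Iff.rfl
  mul_mem' := fun {g h} hg hh m v => (hg m (h v)).trans (hh m v)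
  inv_mem' := fun {g} hg m v => by
    rw [← hg m (g⁻¹ v)]
    exact iff_of_eq (congrArg (· ∈ C m) (g.apply_symm_apply v))

/-- The colored nilpotent cone: nilpotent `x` with `x V_m ⊆ V_{m+1}` for each color `m`. -/
def NilCone : Type _ :=
  {x : Module.End F V // IsNilpotent x ∧ ∀ m, ∀ v ∈ C m, x v ∈ C (m + 1)}

theorem conj_mem_nilCone (g : colorGroup C) (x : NilCone C) :
    IsNilpotent (g.1.conj x.1) ∧ ∀ m, ∀ v ∈ C m, (g.1.conj x.1) v ∈ C (m + 1) := by
  refine ⟨?_, fun m v hv => ?_⟩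
  · obtain ⟨k, hk⟩ := x.2.1
    refine ⟨k, ?_⟩
    have : ∀ k : ℕ, (g.1.conj x.1) ^ k = g.1.conj (x.1 ^ k) := fun k =>
      (map_pow (g.1.conjAlgEquiv F) x.1 k).symm
    rw [this, hk, map_zero]
  · rw [LinearEquiv.conj_apply_apply]
    refine (g.2 _ _).2 (x.2.2 m _ ?_)
    exact (g⁻¹).2 m v |>.2 hv

/-- `K` acts on the colored nilpotent cone by conjugation, `g • x = g x g⁻¹`.  Together with the
natural action on `V` this gives the diagonal action on `V × NilCone C`. -/
instance : MulAction (colorGroup C) (NilCone C) where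
  smul g x := ⟨g.1.conj x.1, conj_mem_nilCone C g x⟩
  one_smul _ := Subtype.ext (LinearMap.ext fun _ => rfl)
  mul_smul _ _ _ := Subtype.ext (LinearMap.ext fun _ => rfl)

/-- The set `K \ N` of orbits in the colored nilpotent cone. -/
abbrev NilOrbit : Type _ := MulAction.orbitRel.Quotient (colorGroup C) (NilCone C)

/-- The set `K \ (V × N)` of enhanced orbits. -/
abbrev EnhOrbit : Type _ := MulAction.orbitRel.Quotient (colorGroup C) (V × NilCone C)

/-- The orbit `O_x = K · x`. -/
def nilOrbitOf (x : NilCone C) : NilOrbit C := Quotient.mk _ x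

/-- The orbit `O_{v,x} = K · (v, x)`. -/
def enhOrbitOf (v : V) (x : NilCone C) : EnhOrbit C := Quotient.mk _ (v, x)

/-! ### Bases of type `(λ, ε)` and colored Jordan bases -/

variable {C}

/-- `v_{i,j}` for an arbitrary integer `j`, with value `0` outside of the diagram. -/
noncomputable def extBasis {P : ColoredPartition n} (b : Module.Basis P.Box F V)
    (i : ℕ) (j : ℤ) : V :=
  if h : 1 ≤ j.toNat ∧ j.toNat ≤ P.len i then b ⟨(i, j.toNat), h⟩ else 0

variable (C) in
/-- The labeled basis `v_{i,j}` of `V` is of type `(λ, ε)`: the basis vector `v_{i,j}` has color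
`ε_i + [λ_i - j]`. -/
def IsOfType {P : ColoredPartition n} (b : Module.Basis P.Box F V) : Prop :=
  ∀ p, b p ∈ C (P.boxColor p)

/-- The labeled basis `v_{i,j}` is a Jordan basis for `x`: `x v_{i,j} = v_{i,j-1}` for `j > 1`, and
`x v_{i,1} = 0`. -/
def IsJordanFor {P : ColoredPartition n} (b : Module.Basis P.Box F V) (x : NilCone C) : Prop :=
  ∀ p : P.Box, x.1 (b p) = extBasis b p.1.1 ((p.1.2 : ℤ) - 1)

/-- The vector `∑_{i = 1}^{l(λ)} v_{i, μ_i}`. -/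
noncomputable def markedVector {P : ColoredPartition n} (b : Module.Basis P.Box F V)
    (μ : P.Marking) : V :=
  ∑ i ∈ Finset.range P.length, extBasis b i (μ i)

theorem extBasis_eq {P : ColoredPartition n} (b : Module.Basis P.Box F V) (p : P.Box) :
    extBasis b p.1.1 (p.1.2 : ℤ) = b p := by
  have h : 1 ≤ ((p.1.2 : ℤ)).toNat ∧ ((p.1.2 : ℤ)).toNat ≤ P.len p.1.1 := by
    simpa using p.2
  rw [extBasis, dif_pos h]
  congr 1

/-- If the signatures agree then there is a basis of type `(λ, ε)`. -/
theorem exists_isOfType [NeZero n] [FiniteDimensional F V] (hC : DirectSum.IsInternal C)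
    (P : ColoredPartition n) (hP : P.signature = spaceSignature C) :
    ∃ b : Module.Basis P.Box F V, IsOfType C b := by
  classical
  let e : ∀ m, {p : P.Box // P.boxColor p = m} ≃ Fin (Module.finrank F (C m)) := fun m =>
    Finite.equivFinOfCardEq (congrFun hP m)
  let B := hC.collectedBasis (fun m => (Module.finBasis F (C m)).reindex (e m).symm)
  refine ⟨B.reindex (Equiv.sigmaFiberEquiv P.boxColor), fun p => ?_⟩
  rw [Module.Basis.reindex_apply]
  exact hC.collectedBasis_mem (fun m => (Module.finBasis F (C m)).reindex (e m).symm)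
    ((Equiv.sigmaFiberEquiv P.boxColor).symm p)

theorem color_eq_span {P : ColoredPartition n} {b : Module.Basis P.Box F V}
    (hP : P.signature = spaceSignature C) (hb : IsOfType C b) (m : ZMod n) :
    Submodule.span F (Set.range fun p : {p : P.Box // P.boxColor p = m} => b p.1) = C m := by
  classical
  have : Fintype {p : P.Box // P.boxColor p = m} := Fintype.ofFinite _
  have : FiniteDimensional F V := Module.Finite.of_basis b
  refine Submodule.eq_of_le_of_finrank_eq ?_ ?_
  · rw [Submodule.span_le]
    rintro _ ⟨⟨p, rfl⟩, rfl⟩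
    exact hb p
  · have hli : LinearIndependent F fun p : {p : P.Box // P.boxColor p = m} => b p.1 :=
      b.linearIndependent.comp _ Subtype.val_injective
    rw [finrank_span_eq_card hli, ← Nat.card_eq_fintype_card]
    exact congrFun hP m

theorem extBasis_sub_one_mem {P : ColoredPartition n} {b : Module.Basis P.Box F V}
    (hb : IsOfType C b) (p : P.Box) :
    extBasis b p.1.1 ((p.1.2 : ℤ) - 1) ∈ C (P.boxColor p + 1) := by
  rw [extBasis]
  split_ifs with h
  · convert hb ⟨(p.1.1, ((p.1.2 : ℤ) - 1).toNat), h⟩ using 2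
    have h1 := p.2.1
    have h2 : ((((p.1.2 : ℤ) - 1).toNat : ℕ) : ℤ) = (p.1.2 : ℤ) - 1 := by omega
    simp only [ColoredPartition.boxColor, h2]
    push_cast
    ring
  · exact zero_mem _

theorem pow_apply_extBasis {P : ColoredPartition n} {b : Module.Basis P.Box F V}
    {x : Module.End F V} (hx : ∀ p : P.Box, x (b p) = extBasis b p.1.1 ((p.1.2 : ℤ) - 1))
    (p : P.Box) (k : ℕ) : (x ^ k) (b p) = extBasis b p.1.1 ((p.1.2 : ℤ) - k) := by
  induction k with
  | zero => simpa using (extBasis_eq b p).symm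
  | succ k ih =>
    rw [pow_succ', Module.End.mul_apply, ih]
    have h1 := p.2.1
    have h2 := p.2.2
    rw [extBasis]
    split_ifs with h
    · rw [hx]
      congr 1
      push_cast
      omega
    · rw [map_zero, extBasis, dif_neg]
      push_cast
      omega

/-- Each basis of type `(λ, ε)` is a colored Jordan basis for some `x` in the cone. -/
theorem exists_isJordanFor {P : ColoredPartition n} {b : Module.Basis P.Box F V}
    (hP : P.signature = spaceSignature C) (hb : IsOfType C b) :
    ∃ x : NilCone C, IsJordanFor b x := by
  let x : Module.End F V := b.constr F fun p => extBasis b p.1.1 ((p.1.2 : ℤ) - 1)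
  have hx : ∀ p : P.Box, x (b p) = extBasis b p.1.1 ((p.1.2 : ℤ) - 1) := fun p =>
    b.constr_basis F _ p
  refine ⟨⟨x, ⟨P.len 0, b.ext fun p => ?_⟩, fun m v hv => ?_⟩, hx⟩
  · rw [pow_apply_extBasis hx, extBasis, dif_neg, LinearMap.zero_apply]
    have h1 := p.2.2
    have h2 : P.len p.1.1 ≤ P.len 0 := P.len_antitone (Nat.zero_le _)
    omega
  · rw [← color_eq_span hP hb m] at hv
    induction hv using Submodule.span_induction with
    | mem y hy =>
      obtain ⟨⟨p, rfl⟩, rfl⟩ := hy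
      change x (b p) ∈ _
      rw [hx]
      exact extBasis_sub_one_mem hb p
    | zero => rw [map_zero]; exact zero_mem _
    | add y z _ _ hy hz => rw [map_add]; exact add_mem hy hz
    | smul a y _ hy => rw [map_smul]; exact Submodule.smul_mem _ a hy

/-- If the signatures agree then some `x` in the cone has a colored Jordan basis of
type `(λ, ε)`. -/
theorem exists_typedJordan [NeZero n] [FiniteDimensional F V] (hC : DirectSum.IsInternal C)
    (P : ColoredPartition n) (hP : P.signature = spaceSignature C) :
    ∃ d : Module.Basis P.Box F V × NilCone C, IsOfType C d.1 ∧ IsJordanFor d.1 d.2 := by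
  obtain ⟨b, hb⟩ := exists_isOfType hC P hP
  obtain ⟨x, hx⟩ := exists_isJordanFor hP hb
  exact ⟨(b, x), hb, hx⟩

/-! ### The orbits `O_{λ,ε}` and `Ψ(λ, ε, μ)` -/

/-- The orbit `O_{λ,ε}` of those `x` that have a colored Jordan basis of type `(λ, ε)`; one such
`x` is chosen, and `shapeOrbit_eq` says that the choice does not matter. -/
noncomputable def shapeOrbit [NeZero n] [FiniteDimensional F V] (hC : DirectSum.IsInternal C)
    (P : ColoredPartition n) (hP : P.signature = spaceSignature C) : NilOrbit C :=
  nilOrbitOf C (exists_typedJordan hC P hP).choose.2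

/-- `Ψ(λ, ε, μ)`, the orbit of `(∑ v_{i,μ_i}, x)`, where `v_{i,j}` is a colored Jordan basis for `x`
of type `(λ, ε)`; one such pair is chosen, and `Psi_eq` says that the choice does not matter. -/
noncomputable def Psi [NeZero n] [FiniteDimensional F V] (hC : DirectSum.IsInternal C)
    (P : ColoredPartition n) (hP : P.signature = spaceSignature C) (μ : P.Marking) : EnhOrbit C :=
  enhOrbitOf C (markedVector (exists_typedJordan hC P hP).choose.1 μ)
    (exists_typedJordan hC P hP).choose.2

/-- The map `K \ (V × N) → K \ N` induced by the projection `V × N → N`. -/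
def projOrbit (O : EnhOrbit C) : NilOrbit C :=
  Quotient.map' (s₁ := MulAction.orbitRel (colorGroup C) (V × NilCone C))
    (s₂ := MulAction.orbitRel (colorGroup C) (NilCone C)) Prod.snd
    (by rintro _ b ⟨g, rfl⟩; exact ⟨g, rfl⟩) O

theorem exists_transport {P : ColoredPartition n} (hP : P.signature = spaceSignature C)
    {b b' : Module.Basis P.Box F V} {x x' : NilCone C} (hb : IsOfType C b) (hx : IsJordanFor b x)
    (hb' : IsOfType C b') (hx' : IsJordanFor b' x') :
    ∃ g : colorGroup C, g • x = x' ∧ ∀ μ : P.Marking, g • markedVector b μ = markedVector b' μ := by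
  have key : ∀ {b b' : Module.Basis P.Box F V}, IsOfType C b → IsOfType C b' → ∀ m v, v ∈ C m →
      b.equiv b' (Equiv.refl _) v ∈ C m := by
    intro b b' hb hb' m v hv
    rw [← color_eq_span hP hb m] at hv
    induction hv using Submodule.span_induction with
    | mem y hy =>
      obtain ⟨⟨p, rfl⟩, rfl⟩ := hy
      simpa using hb' p
    | zero => rw [map_zero]; exact zero_mem _
    | add y z _ _ hy hz => rw [map_add]; exact add_mem hy hz
    | smul a y _ hy => rw [map_smul]; exact Submodule.smul_mem _ a hy
  let g : V ≃ₗ[F] V := b.equiv b' (Equiv.refl _)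
  have hext : ∀ i j, g (extBasis b i j) = extBasis b' i j := by
    intro i j
    rw [extBasis, extBasis]
    split_ifs with h
    · simp [g]
    · exact map_zero g
  have hg : g ∈ colorGroup C := fun m v => by
    refine ⟨fun h => ?_, key hb hb' m v⟩
    have h2 := key hb' hb m _ h
    have h3 : b'.equiv b (Equiv.refl _) = g.symm := by
      simp only [g, Module.Basis.equiv_symm, Equiv.refl_symm]
    rwa [h3, g.symm_apply_apply] at h2
  refine ⟨⟨g, hg⟩, Subtype.ext (b'.ext fun p => ?_), fun μ => ?_⟩
  · have h1 : g.symm (b' p) = b p := by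
      rw [LinearEquiv.symm_apply_eq]; simp [g]
    change g (x.1 (g.symm (b' p))) = x'.1 (b' p)
    rw [h1, hx, hx', hext]
  · change g (markedVector b μ) = _
    rw [markedVector, map_sum]
    exact Finset.sum_congr rfl fun i _ => hext i _

theorem shapeOrbit_eq [NeZero n] [FiniteDimensional F V] (hC : DirectSum.IsInternal C)
    {P : ColoredPartition n} (hP : P.signature = spaceSignature C)
    {b : Module.Basis P.Box F V} {x : NilCone C} (hb : IsOfType C b) (hx : IsJordanFor b x) :
    shapeOrbit hC P hP = nilOrbitOf C x := by
  obtain ⟨hb', hx'⟩ := (exists_typedJordan hC P hP).choose_spec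
  obtain ⟨g, hg, -⟩ := exists_transport hP hb hx hb' hx'
  exact Quotient.sound ⟨g, hg⟩

theorem Psi_eq [NeZero n] [FiniteDimensional F V] (hC : DirectSum.IsInternal C)
    {P : ColoredPartition n} (hP : P.signature = spaceSignature C) (μ : P.Marking)
    {b : Module.Basis P.Box F V} {x : NilCone C} (hb : IsOfType C b) (hx : IsJordanFor b x) :
    Psi hC P hP μ = enhOrbitOf C (markedVector b μ) x := by
  obtain ⟨hb', hx'⟩ := (exists_typedJordan hC P hP).choose_spec
  obtain ⟨g, hg, hv⟩ := exists_transport hP hb hx hb' hx'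
  exact Quotient.sound ⟨g, Prod.ext (hv μ) hg⟩

/-- The image of `Ψ`: the orbits `Ψ(α, β, γ)` for all marked colored partitions `(α, β, γ)` of
signature `ξ(V)`. -/
def psiImage [NeZero n] [FiniteDimensional F V] (hC : DirectSum.IsInternal C) :
    Set (EnhOrbit C) :=
  {O | ∃ (Q : ColoredPartition n) (hQ : Q.signature = spaceSignature C) (γ : Q.Marking),
    Psi hC Q hQ γ = O}

/-- The set `S_O` of nonnegative markings `μ` of `λ` with `Ψ(λ, ε, μ) = O`. -/
def markingsOf [NeZero n] [FiniteDimensional F V] (hC : DirectSum.IsInternal C)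
    (P : ColoredPartition n) (hP : P.signature = spaceSignature C) (O : EnhOrbit C) :
    Set P.Marking :=
  {μ | Psi hC P hP μ = O ∧ ∀ i, 0 ≤ μ i}

/-- `μ` is a minimal marking for `O`: `μ ∈ S_O`, and `δ = μ` for each `δ ∈ S_O` with `δ ≤ μ`. -/
def IsMinimalMarking [NeZero n] [FiniteDimensional F V] (hC : DirectSum.IsInternal C)
    (P : ColoredPartition n) (hP : P.signature = spaceSignature C) (O : EnhOrbit C)
    (μ : P.Marking) : Prop :=
  μ ∈ markingsOf hC P hP O ∧ ∀ δ ∈ markingsOf hC P hP O, δ ≤ μ → δ = μ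

end Spaces

end ColoredCone

namespace ColoredCone

/-! Fix `x` with a colored Jordan basis. Two markings give the same orbit exactly when an element of
`K` centralizing `x` carries one marked vector to the other. Say that one mark dominates another of
the same color if its `μ` is at least as large and its `λ - μ` at most as large.

Suppose the mark in row `i` dominates the one in row `j`. The nilpotent map shifting row `i` onto
row `j` sends `v_{i,μ_i}` to `v_{j,μ_j}` and commutes with `x`, so adding it to the identity
restores an erased mark in row `j` (`Psi_erase`). Hence a minimal marking has no dominated positive
marks, which is the strictness condition of part 4 (`IsMinimalMarking.isStrictMarking`).

Conversely, kernels and images of powers of `x`, tested on color components, show that each positive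
mark of `μ` is dominated by some mark of any `δ` in the same orbit (`exists_mark_dominating`). Going
to `δ` and back, strictness of `μ` forces a return to the starting row, so every inequality is an
equality (`IsStrictMarking.exists_row_eq`). Two strict markings of one orbit are therefore
row-equivalent. In particular their marks have the same total, so neither can lie strictly below the
other; as `S_O` is finite, strict markings are minimal.

`S_O` is nonempty because the dimensions of `x ^ k V_m` determine the type of `x` up to a
permutation of rows (`markingsOf_nonempty`). -/

theorem exists_perm_of_fiber_equiv {ι α : Type*} {f g : ι → α}
    (h : ∀ a, Nonempty ({i // g i = a} ≃ {i // f i = a})) :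
    ∃ σ : Equiv.Perm ι, ∀ i, g i = f (σ i) := by
  let e := fun a => (h a).some
  refine ⟨(Equiv.sigmaFiberEquiv g).symm.trans
    ((Equiv.sigmaCongrRight e).trans (Equiv.sigmaFiberEquiv f)), fun i => ?_⟩
  exact ((e (g i)) ⟨i, rfl⟩).2.symm

/-! ### Counting rows and boxes of colored partitions -/

namespace ColoredPartition

variable {n : ℕ} (P : ColoredPartition n)

theorem finite_setOf_len_pos : {i | 0 < P.len i}.Finite := by
  obtain ⟨N, hN⟩ := P.exists_len_eq_zero
  refine (Set.finite_Iio N).subset fun i hi => ?_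
  by_contra h
  have := P.len_antitone (not_lt.mp h)
  simp only [Set.mem_ofPred_eq] at hi
  omega

theorem lt_length_iff (i : ℕ) : i < P.length ↔ 0 < P.len i := by
  have h := Nat.find_spec P.exists_len_eq_zero
  have hset : {i | 0 < P.len i} = Set.Iio (Nat.find P.exists_len_eq_zero) := by
    ext j
    simp only [Set.mem_ofPred_eq, Set.mem_Iio]
    constructor
    · intro hj
      by_contra hlt
      have := P.len_antitone (not_lt.mp hlt)
      omega
    · intro hj
      exact Nat.pos_of_ne_zero (Nat.find_min P.exists_len_eq_zero hj)
  have hlen : P.length = Nat.find P.exists_len_eq_zero := by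
    rw [length, hset, ← Finset.coe_Iio, Set.ncard_coe_finset, Nat.card_Iio]
  rw [hlen]
  exact (Set.ext_iff.mp hset i).symm

/-- The number of rows of length `l` and color `c` is a difference of numbers of boxes. -/
theorem card_rows_add_card_boxes (l : ℕ) (m : ZMod n) (hl : 0 < l) :
    {i | l ≤ P.len i ∧ P.color i + P.len i = m + l}.ncard
      + {p : P.Box | l < p.1.2 ∧ P.boxColor p = m}.ncard =
    {p : P.Box | l - 1 < p.1.2 ∧ P.boxColor p = m}.ncard := by
  -- A row has at most one box in column `l`, and that box has color `m` exactly when `ε_i + [λ_i] =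
  -- m + [l]`.
  have h1 : {p : P.Box | p.1.2 = l ∧ P.boxColor p = m}.ncard =
      {i | l ≤ P.len i ∧ P.color i + P.len i = m + l}.ncard := by
    refine Set.ncard_congr (fun p _ => p.1.1) ?_ ?_ ?_
    · rintro ⟨⟨i, j⟩, hp⟩ ⟨rfl, rfl⟩
      refine ⟨hp.2, ?_⟩
      simp only [boxColor]
      push_cast
      ring
    · rintro ⟨⟨i, j⟩, hp⟩ ⟨⟨i', j'⟩, hp'⟩ ⟨h1, -⟩ ⟨h2, -⟩ h
      simp only at h1 h2 h
      subst h1 h2 h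
      rfl
    · rintro i ⟨h1, h2⟩
      refine ⟨⟨(i, l), hl, h1⟩, ⟨rfl, ?_⟩, rfl⟩
      simp only [boxColor]
      push_cast
      rw [← add_sub_assoc, h2, add_sub_cancel_right]
  rw [← h1, ← Set.ncard_union_eq]
  · congr 1
    ext p
    simp only [Set.mem_union, Set.mem_ofPred_eq]
    constructor
    · rintro (⟨h, h'⟩ | ⟨h, h'⟩) <;> exact ⟨by omega, h'⟩
    · rintro ⟨h, h'⟩
      rcases (show p.1.2 = l ∨ l < p.1.2 by omega) with h2 | h2
      · exact Or.inl ⟨h2, h'⟩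
      · exact Or.inr ⟨h2, h'⟩
  · rw [Set.disjoint_left]
    rintro p ⟨h, -⟩ ⟨h', -⟩
    omega

/-- Differencing box counts in the column gives the number of rows of length at least `l` with a
given value of `ε_i + [λ_i]`. Differencing again fixes the length, and then that value determines
the color. -/
theorem card_rows_eq_of_card_boxes_eq {Q : ColoredPartition n}
    (h : ∀ (k : ℕ) (m : ZMod n), {p : P.Box | k < p.1.2 ∧ P.boxColor p = m}.ncard =
      {p : Q.Box | k < p.1.2 ∧ Q.boxColor p = m}.ncard) (l : ℕ) (hl : 0 < l) (c : ZMod n) :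
    {i | P.len i = l ∧ P.color i = c}.ncard = {i | Q.len i = l ∧ Q.color i = c}.ncard := by
  have hA : ∀ (l : ℕ) (_ : 0 < l) (c : ZMod n),
      {i | l ≤ P.len i ∧ P.color i + P.len i = c}.ncard =
      {i | l ≤ Q.len i ∧ Q.color i + Q.len i = c}.ncard := by
    intro l hl c
    have hP := P.card_rows_add_card_boxes l (c - l) hl
    have hQ := Q.card_rows_add_card_boxes l (c - l) hl
    rw [sub_add_cancel] at hP hQ
    have h1 := h l (c - l)
    have h2 := h (l - 1) (c - l)
    omega
  have hB : ∀ R : ColoredPartition n, {i | R.len i = l ∧ R.color i = c}.ncard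
      + {i | l + 1 ≤ R.len i ∧ R.color i + R.len i = c + l}.ncard
      = {i | l ≤ R.len i ∧ R.color i + R.len i = c + l}.ncard := by
    intro R
    have hfin : ∀ s : Set ℕ, (∀ i ∈ s, l ≤ R.len i) → s.Finite := fun s hs =>
      R.finite_setOf_len_pos.subset fun i hi => hl.trans_le (hs i hi)
    rw [← Set.ncard_union_eq ?_ (hfin _ fun i hi => hi.1.ge)
      (hfin _ fun i hi => (Nat.le_succ l).trans hi.1)]
    · congr 1
      ext i
      simp only [Set.mem_union, Set.mem_ofPred_eq]
      constructor
      · rintro (⟨rfl, rfl⟩ | ⟨h, h'⟩)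
        · exact ⟨le_rfl, rfl⟩
        · exact ⟨by omega, h'⟩
      · rintro ⟨h, h'⟩
        rcases h.eq_or_lt with rfl | h2
        · exact Or.inl ⟨rfl, add_right_cancel h'⟩
        · exact Or.inr ⟨h2, h'⟩
    · rw [Set.disjoint_left]
      rintro p ⟨h, -⟩ ⟨h', -⟩
      omega
  have h1 := hB P
  have h2 := hB Q
  have h3 := hA l hl (c + l)
  have h4 := hA (l + 1) l.succ_pos (c + l)
  omega

theorem infinite_len_zero (c : ZMod n) : {i | P.len i = 0 ∧ P.color i = c}.Infinite := by
  refine ((P.infinite_color c).sdiff P.finite_setOf_len_pos).mono ?_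
  rintro i ⟨h1, h2⟩
  simp only [Set.mem_ofPred_eq] at h1 h2 ⊢
  exact ⟨by omega, h1⟩

/-- Nonempty rows are matched by finite counts. Empty rows of each color are countably infinite on
both sides, because every color occurs infinitely often. -/
theorem exists_perm_of_card_boxes_eq {Q : ColoredPartition n}
    (h : ∀ (k : ℕ) (m : ZMod n), {p : P.Box | k < p.1.2 ∧ P.boxColor p = m}.ncard =
      {p : Q.Box | k < p.1.2 ∧ Q.boxColor p = m}.ncard) :
    ∃ σ : Equiv.Perm ℕ, ∀ i, Q.len i = P.len (σ i) ∧ Q.color i = P.color (σ i) := by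
  obtain ⟨σ, hσ⟩ := exists_perm_of_fiber_equiv (f := fun i => (P.len i, P.color i))
    (g := fun i => (Q.len i, Q.color i)) (by
      rintro ⟨l, c⟩
      simp only [Prod.mk.injEq]
      rcases Nat.eq_zero_or_pos l with rfl | hl
      · have h1 := (P.infinite_len_zero c).to_subtype
        have h2 := (Q.infinite_len_zero c).to_subtype
        exact nonempty_equiv_of_countable (α := {i | Q.len i = 0 ∧ Q.color i = c})
          (β := {i | P.len i = 0 ∧ P.color i = c})
      · have hfin : ∀ R : ColoredPartition n, Finite {i | R.len i = l ∧ R.color i = c} :=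
          fun R => (R.finite_setOf_len_pos.subset fun i hi => by
            have := hi.1; simp only [Set.mem_ofPred_eq]; omega).to_subtype
        have := hfin P
        have := hfin Q
        have h3 := P.card_rows_eq_of_card_boxes_eq h l hl c
        exact (Finite.card_eq (α := {i | Q.len i = l ∧ Q.color i = c})
          (β := {i | P.len i = l ∧ P.color i = c})).mp h3.symm)
  exact ⟨σ, fun i => Prod.ext_iff.mp (hσ i)⟩

/-- Rows of a fixed length and color with positive marks are told apart by their marks, and the
marks that occur agree; hence the markings are row-equivalent. -/
theorem rowEquivalent_of_forall_exists {μ δ : P.Marking} (hμ : ∀ i, 0 ≤ μ i) (hδ : ∀ i, 0 ≤ δ i)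
    (injμ : ∀ i j, P.len i = P.len j → P.color i = P.color j → 0 < μ i → μ i = μ j → i = j)
    (injδ : ∀ i j, P.len i = P.len j → P.color i = P.color j → 0 < δ i → δ i = δ j → i = j)
    (hμδ : ∀ i, 0 < μ i → ∃ j, P.len j = P.len i ∧ P.color j = P.color i ∧ δ j = μ i)
    (hδμ : ∀ i, 0 < δ i → ∃ j, P.len j = P.len i ∧ P.color j = P.color i ∧ μ j = δ i) :
    RowEquivalent P P μ δ := by
  obtain ⟨σ, hσ⟩ := exists_perm_of_fiber_equiv (f := fun i => (P.len i, P.color i, μ i))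
    (g := fun i => (P.len i, P.color i, δ i)) (by
      rintro ⟨l, c, k⟩
      simp only [Prod.mk.injEq]
      rcases lt_trichotomy k 0 with hk | rfl | hk
      · refine ⟨@Equiv.equivOfIsEmpty _ _ ⟨?_⟩ ⟨?_⟩⟩
        · rintro ⟨i, h⟩; have := hδ i; omega
        · rintro ⟨i, h⟩; have := hμ i; omega
      -- On empty rows a nonnegative mark must be `0`, so the two fibers coincide. For `l > 0` the
      -- rows marked `0` are counted as the complement of the positively marked ones in a finite
      -- set.
      · rcases Nat.eq_zero_or_pos l with rfl | hl
        · refine ⟨Equiv.subtypeEquivRight fun i => ?_⟩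
          have h1 := hμ i
          have h2 := hδ i
          have h3 := μ.2 i
          have h4 := δ.2 i
          constructor
          · rintro ⟨h5, h6, -⟩; exact ⟨h5, h6, by rw [h5] at h3; push_cast at h3; omega⟩
          · rintro ⟨h5, h6, -⟩; exact ⟨h5, h6, by rw [h5] at h4; push_cast at h4; omega⟩
        · have hT : {i | P.len i = l ∧ P.color i = c}.Finite :=
            P.finite_setOf_len_pos.subset fun i hi => by
              have := hi.1; simp only [Set.mem_ofPred_eq]; omega
          have hadd : ∀ ν : P.Marking, (∀ i, 0 ≤ ν i) →
              {i | P.len i = l ∧ P.color i = c ∧ ν i = 0}.ncard +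
              {i | P.len i = l ∧ P.color i = c ∧ 0 < ν i}.ncard =
              {i | P.len i = l ∧ P.color i = c}.ncard := by
            intro ν hν
            rw [← Set.ncard_union_eq _ (hT.subset fun i hi => ⟨hi.1, hi.2.1⟩)
              (hT.subset fun i hi => ⟨hi.1, hi.2.1⟩)]
            · congr 1
              ext i
              have := hν i
              simp only [Set.mem_union, Set.mem_ofPred_eq]
              constructor
              · rintro (⟨h, h', -⟩ | ⟨h, h', -⟩) <;> exact ⟨h, h'⟩
              · rintro ⟨h, h'⟩
                rcases this.eq_or_lt with h2 | h2
                · exact Or.inl ⟨h, h', h2.symm⟩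
                · exact Or.inr ⟨h, h', h2⟩
            · rw [Set.disjoint_left]
              rintro i ⟨-, -, h⟩ ⟨-, -, h'⟩
              omega
          -- By injectivity both sides count the positive marks that occur, and these form the same
          -- set.
          have hpos : {i | P.len i = l ∧ P.color i = c ∧ 0 < μ i}.ncard =
              {i | P.len i = l ∧ P.color i = c ∧ 0 < δ i}.ncard := by
            rw [← Set.InjOn.ncard_image (f := fun i => μ i)
                (s := {i | P.len i = l ∧ P.color i = c ∧ 0 < μ i}),
              ← Set.InjOn.ncard_image (f := fun i => δ i)
                (s := {i | P.len i = l ∧ P.color i = c ∧ 0 < δ i})]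
            · congr 1
              apply Set.Subset.antisymm
              · rintro _ ⟨i, ⟨h1, h2, h3⟩, rfl⟩
                obtain ⟨j, hj1, hj2, hj3⟩ := hμδ i h3
                exact ⟨j, ⟨hj1.trans h1, hj2.trans h2, hj3 ▸ h3⟩, hj3⟩
              · rintro _ ⟨i, ⟨h1, h2, h3⟩, rfl⟩
                obtain ⟨j, hj1, hj2, hj3⟩ := hδμ i h3
                exact ⟨j, ⟨hj1.trans h1, hj2.trans h2, hj3 ▸ h3⟩, hj3⟩
            · rintro i ⟨h1, h2, h3⟩ j ⟨h4, h5, -⟩ h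
              exact injδ i j (h1.trans h4.symm) (h2.trans h5.symm) h3 h
            · rintro i ⟨h1, h2, h3⟩ j ⟨h4, h5, -⟩ h
              exact injμ i j (h1.trans h4.symm) (h2.trans h5.symm) h3 h
          have e1 := hadd μ hμ
          have e2 := hadd δ hδ
          have := (hT.subset (t := {i | P.len i = l ∧ P.color i = c ∧ μ i = 0})
            fun i hi => ⟨hi.1, hi.2.1⟩).to_subtype
          have := (hT.subset (t := {i | P.len i = l ∧ P.color i = c ∧ δ i = 0})
            fun i hi => ⟨hi.1, hi.2.1⟩).to_subtype
          exact (Finite.card_eq (α := {i | P.len i = l ∧ P.color i = c ∧ δ i = 0})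
            (β := {i | P.len i = l ∧ P.color i = c ∧ μ i = 0})).mp
            (show Set.ncard _ = Set.ncard _ by omega)
      · have s1 : Subsingleton {i // P.len i = l ∧ P.color i = c ∧ μ i = k} := by
          refine ⟨?_⟩
          rintro ⟨i, h1, h2, h3⟩ ⟨j, h4, h5, h6⟩
          exact Subtype.ext (injμ i j (h1.trans h4.symm) (h2.trans h5.symm) (h3 ▸ hk)
            (h3.trans h6.symm))
        have s2 : Subsingleton {i // P.len i = l ∧ P.color i = c ∧ δ i = k} := by
          refine ⟨?_⟩
          rintro ⟨i, h1, h2, h3⟩ ⟨j, h4, h5, h6⟩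
          exact Subtype.ext (injδ i j (h1.trans h4.symm) (h2.trans h5.symm) (h3 ▸ hk)
            (h3.trans h6.symm))
        classical
        by_cases hne : ∃ i, P.len i = l ∧ P.color i = c ∧ μ i = k
        · obtain ⟨i, h1, h2, h3⟩ := hne
          obtain ⟨j, hj1, hj2, hj3⟩ := hμδ i (h3 ▸ hk)
          exact ⟨equivOfSubsingletonOfSubsingleton (fun _ => ⟨i, h1, h2, h3⟩)
            fun _ => ⟨j, hj1.trans h1, hj2.trans h2, hj3.trans h3⟩⟩
        · refine ⟨@Equiv.equivOfIsEmpty _ _ ⟨?_⟩ ⟨fun i => hne ⟨i.1, i.2⟩⟩⟩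
          rintro ⟨j, h1, h2, h3⟩
          obtain ⟨i, hi1, hi2, hi3⟩ := hδμ j (h3 ▸ hk)
          exact hne ⟨i, hi1.trans h1, hi2.trans h2, hi3.trans h3⟩)
  exact ⟨σ, fun i => by simpa [Prod.ext_iff] using hσ i⟩

end ColoredPartition

/-! ### Color components and heights -/

section Spaces

variable {n : ℕ} {F V : Type*} [Field F] [AddCommGroup V] [Module F V]
variable {C : ZMod n → Submodule F V} {P : ColoredPartition n} {b : Module.Basis P.Box F V}

theorem extBasis_of_nonpos {i : ℕ} {t : ℤ} (ht : t ≤ 0) : extBasis b i t = 0 := by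
  rw [extBasis, dif_neg]
  omega

theorem extBasis_of_pos {i : ℕ} {t : ℤ} (ht : 0 < t) (ht' : t ≤ P.len i) :
    extBasis b i t = b ⟨(i, t.toNat), by dsimp only; omega⟩ := by
  rw [extBasis, dif_pos]

theorem extBasis_mem (hb : IsOfType C b) (i : ℕ) (t : ℤ) :
    extBasis b i t ∈ C (P.color i + (((P.len i : ℤ) - t : ℤ) : ZMod n)) := by
  rw [extBasis]
  split_ifs with h
  · convert hb ⟨(i, t.toNat), h⟩ using 2
    have h2 : ((t.toNat : ℕ) : ℤ) = t := by omega
    simp only [ColoredPartition.boxColor, h2]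
  · exact zero_mem _

/-- The bound on `t` matters: beyond the right end of the row `extBasis` is `0`, yet the shifted
index could reenter the diagram. -/
theorem pow_extBasis {x : NilCone C} (hx : IsJordanFor b x) {i : ℕ} {t : ℤ} (ht : t ≤ P.len i)
    (k : ℕ) : (x.1 ^ k) (extBasis b i t) = extBasis b i (t - k) := by
  rcases le_or_gt t 0 with h | h
  · rw [extBasis_of_nonpos h, extBasis_of_nonpos (by omega), map_zero]
  · rw [extBasis_of_pos h ht, pow_apply_extBasis hx]
    congr 1
    dsimp only
    omega

theorem apply_extBasis {x : NilCone C} (hx : IsJordanFor b x) {i : ℕ} {t : ℤ}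
    (ht : t ≤ P.len i) : x.1 (extBasis b i t) = extBasis b i (t - 1) := by
  simpa using pow_extBasis hx ht 1

theorem repr_extBasis (i : ℕ) (t : ℤ) (p : P.Box) :
    b.repr (extBasis b i t) p = if i = p.1.1 ∧ t = p.1.2 then 1 else 0 := by
  classical
  rw [extBasis]
  have hp := p.2
  split_ifs with h h' h'
  · have : (⟨(i, t.toNat), h⟩ : P.Box) = p := by
      refine Subtype.ext (Prod.ext h'.1 ?_)
      dsimp only
      omega
    rw [this, Module.Basis.repr_self, Finsupp.single_eq_same]
  · rw [Module.Basis.repr_self, Finsupp.single_eq_of_ne]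
    rintro rfl
    exact h' ⟨rfl, by dsimp only at h ⊢; omega⟩
  · obtain ⟨rfl, rfl⟩ := h'
    exact absurd (by simpa using hp) h
  · simp

/-- A linear map that respects the colors of a basis of type `(λ, ε)` preserves each `V_m`. -/
theorem map_mem_of_basis (hP : P.signature = spaceSignature C) (hb : IsOfType C b)
    {f : V →ₗ[F] V} (hf : ∀ p, f (b p) ∈ C (P.boxColor p)) {m : ZMod n} {v : V} (hv : v ∈ C m) :
    f v ∈ C m := by
  rw [← color_eq_span hP hb m] at hv
  have : Submodule.span F (Set.range fun p : {p : P.Box // P.boxColor p = m} => b p.1) ≤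
      (C m).comap f := by
    rw [Submodule.span_le]
    rintro _ ⟨⟨p, rfl⟩, rfl⟩
    exact hf p
  exact this hv

/-- The projection of `V` to `V_m` determined by a basis of type `(λ, ε)`. -/
noncomputable def colorProj (b : Module.Basis P.Box F V) (m : ZMod n) : V →ₗ[F] V :=
  open Classical in b.constr F fun p => if P.boxColor p = m then b p else 0

open Classical in
theorem colorProj_of_mem (hP : P.signature = spaceSignature C) (hb : IsOfType C b)
    {m m' : ZMod n} {v : V} (hv : v ∈ C m') : colorProj b m v = if m' = m then v else 0 := by
  rw [← color_eq_span hP hb m'] at hv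
  have hbase : ∀ p, colorProj b m (b p) = if P.boxColor p = m then b p else 0 := fun p => by
    rw [colorProj, b.constr_basis]
  split_ifs with h
  · refine LinearMap.eqOn_span (f := colorProj b m) (g := LinearMap.id) ?_ hv
    rintro _ ⟨⟨p, rfl⟩, rfl⟩
    rw [hbase, if_pos h, LinearMap.id_apply]
  · refine LinearMap.eqOn_span (f := colorProj b m) (g := 0) ?_ hv
    rintro _ ⟨⟨p, rfl⟩, rfl⟩
    rw [hbase, if_neg h, LinearMap.zero_apply]

theorem colorProj_comm (hP : P.signature = spaceSignature C) (hb : IsOfType C b)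
    (g : colorGroup C) (m : ZMod n) (v : V) : colorProj b m (g.1 v) = g.1 (colorProj b m v) := by
  classical
  have : colorProj b m ∘ₗ g.1.toLinearMap = g.1.toLinearMap ∘ₗ colorProj b m := by
    refine b.ext fun p => ?_
    simp only [LinearMap.comp_apply, LinearEquiv.coe_coe]
    rw [colorProj_of_mem hP hb (hb p), colorProj_of_mem hP hb ((g.2 _ _).2 (hb p))]
    split_ifs
    · rfl
    · rw [map_zero]
  exact LinearMap.congr_fun this v

open Classical in
theorem colorProj_markedVector (hP : P.signature = spaceSignature C) (hb : IsOfType C b)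
    (m : ZMod n) (μ : P.Marking) : colorProj b m (markedVector b μ) =
      ∑ i ∈ Finset.range P.length, if P.markColor μ i = m then extBasis b i (μ i) else 0 := by
  rw [markedVector, map_sum]
  exact Finset.sum_congr rfl fun i _ => colorProj_of_mem hP hb (extBasis_mem hb i (μ i))

theorem conj_eq_iff_comm {g : colorGroup C} {x : NilCone C} :
    g • x = x ↔ ∀ v, g.1 (x.1 v) = x.1 (g.1 v) := by
  constructor
  · intro h v
    have h2 : g.1.conj x.1 (g.1 v) = x.1 (g.1 v) :=
      LinearMap.congr_fun (congrArg Subtype.val h) (g.1 v)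
    rwa [LinearEquiv.conj_apply_apply, LinearEquiv.symm_apply_apply] at h2
  · intro h
    refine Subtype.ext (LinearMap.ext fun v => ?_)
    change g.1 (x.1 (g.1.symm v)) = x.1 v
    rw [h, LinearEquiv.apply_symm_apply]

/-- To land in column `1` of a row after `λ_i` steps, a basis vector would have to start in column
`λ_i + 1`. -/
theorem repr_pow_apply_eq_zero {x : NilCone C} (hx : IsJordanFor b x) (p : P.Box)
    (hp : p.1.2 = 1) (v : V) : b.repr ((x.1 ^ P.len p.1.1) v) p = 0 := by
  have : b.coord p ∘ₗ (x.1 ^ P.len p.1.1) = 0 := by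
    refine b.ext fun q => ?_
    rw [LinearMap.comp_apply, pow_apply_extBasis hx, Module.Basis.coord_apply, repr_extBasis,
      if_neg, LinearMap.zero_apply]
    rintro ⟨h1, h2⟩
    have := q.2.2
    rw [h1] at this
    omega
  exact LinearMap.congr_fun this v

/-- Comparison of heights: the color components of `v` and `g v` have the same heights under the
powers of `x`, for `g` in the centralizer of `x` in `K`. -/
theorem exists_mark_dominating (hP : P.signature = spaceSignature C) (hb : IsOfType C b)
    {x : NilCone C} (hx : IsJordanFor b x) {μ δ : P.Marking} {g : colorGroup C}
    (hgx : g • x = x) (hg : g.1 (markedVector b δ) = markedVector b μ) {i : ℕ} (hi : 0 < μ i) :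
    ∃ j, P.markColor δ j = P.markColor μ i ∧ μ i ≤ δ j ∧
      (P.len j : ℤ) - δ j ≤ (P.len i : ℤ) - μ i := by
  classical
  by_contra! hcon
  have hμi := μ.2 i
  set m := P.markColor μ i with hm
  -- This power moves the mark in row `i` to column `1`, the last place before it dies.
  obtain ⟨k, hk⟩ : ∃ k : ℕ, (k : ℤ) = μ i - 1 := ⟨(μ i - 1).toNat, by omega⟩
  have hcomm : ∀ (k : ℕ) v, g.1 ((x.1 ^ k) v) = (x.1 ^ k) (g.1 v) := by
    intro k
    induction k with
    | zero => intro v; rfl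
    | succ k ih =>
      intro v
      rw [pow_succ, Module.End.mul_apply, Module.End.mul_apply, ih, conj_eq_iff_comm.mp hgx]
  -- If no mark of `δ` dominates, each one of color `m` is either less than `μ i`, hence killed by
  -- `x ^ k`, or has `λ_j - δ_j > λ_i - μ_i`, which leaves room for a preimage `λ_i` columns to the
  -- right of its image.
  have hδ : (x.1 ^ k) (colorProj b m (markedVector b δ)) ∈ LinearMap.range (x.1 ^ P.len i) := by
    rw [colorProj_markedVector hP hb, map_sum]
    refine Submodule.sum_mem _ fun j _ => ?_
    split_ifs with hj
    · have hδj := δ.2 j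
      rw [pow_extBasis hx hδj]
      rcases lt_or_ge (δ j) (μ i) with h | h
      · rw [extBasis_of_nonpos (by omega)]
        exact zero_mem _
      · have h2 := hcon j hj h
        refine ⟨extBasis b j (δ j - k + P.len i), ?_⟩
        rw [pow_extBasis hx (by omega)]
        congr 1
        ring
    · rw [map_zero]
      exact zero_mem _
  obtain ⟨y, hy⟩ := hδ
  have hμ : (x.1 ^ k) (colorProj b m (markedVector b μ)) = (x.1 ^ P.len i) (g.1 y) := by
    rw [← hg, colorProj_comm hP hb, ← hcomm, ← hy, hcomm]
  -- At this box the vector for `μ` has coefficient `1`, since the other marks lie in other rows; an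
  -- element of the range of `x ^ λ_i` has coefficient `0`.
  let p : P.Box := ⟨(i, 1), le_rfl, by dsimp only; omega⟩
  have h0 : b.repr ((x.1 ^ k) (colorProj b m (markedVector b μ))) p = 0 := by
    rw [hμ]
    exact repr_pow_apply_eq_zero hx p rfl _
  rw [colorProj_markedVector hP hb, map_sum, map_sum, Finsupp.finsetSum_apply,
    Finset.sum_eq_single i] at h0
  · rw [if_pos rfl, pow_extBasis hx hμi, repr_extBasis, if_pos] at h0
    · exact one_ne_zero h0
    · exact ⟨rfl, by simp only [p]; push_cast; omega⟩
  · intro j _ hj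
    split_ifs
    · rw [pow_extBasis hx (μ.2 j), repr_extBasis, if_neg]
      exact fun h => hj h.1
    · simp
  · intro h
    exact absurd (Finset.mem_range.mpr ((P.lt_length_iff i).mpr (by omega))) h

/-! ### Row shifts and the unipotent elements they give -/

/-- The map sending row `i` to row `j`, with columns shifted by `d`, and killing the other rows. -/
noncomputable def rowShift (b : Module.Basis P.Box F V) (i j : ℕ) (d : ℤ) : V →ₗ[F] V :=
  b.constr F fun p => if p.1.1 = i then extBasis b j ((p.1.2 : ℤ) - d) else 0

theorem rowShift_basis (i j : ℕ) (d : ℤ) (p : P.Box) :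
    rowShift b i j d (b p) = if p.1.1 = i then extBasis b j ((p.1.2 : ℤ) - d) else 0 := by
  rw [rowShift, b.constr_basis]

theorem rowShift_extBasis {i j : ℕ} {d : ℤ} (hd : 0 ≤ d) {i' : ℕ} {t : ℤ} (ht : t ≤ P.len i') :
    rowShift b i j d (extBasis b i' t) = if i' = i then extBasis b j (t - d) else 0 := by
  rcases le_or_gt t 0 with h | h
  · rw [extBasis_of_nonpos h, extBasis_of_nonpos (by omega), map_zero, ite_self]
  · rw [extBasis_of_pos h ht, rowShift_basis]
    dsimp only
    rw [Int.toNat_of_nonneg h.le]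

theorem rowShift_rowShift {i j : ℕ} (hij : i ≠ j) {d : ℤ} (hd : 0 ≤ d)
    (hd' : (P.len i : ℤ) - d ≤ P.len j) (v : V) :
    rowShift b i j d (rowShift b i j d v) = 0 := by
  have : rowShift b i j d ∘ₗ rowShift b i j d = 0 := by
    refine b.ext fun p => ?_
    rw [LinearMap.comp_apply, rowShift_basis, LinearMap.zero_apply]
    split_ifs with h
    · have := p.2.2
      rw [h] at this
      rw [rowShift_extBasis hd (by omega), if_neg hij.symm]
    · rw [map_zero]
  exact LinearMap.congr_fun this v

/-- Both inequalities serve commutation: `0 ≤ d` sends `v_{i,1}`, which `x` kills, to a vector `x`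
kills, and `λ_i - d ≤ λ_j` keeps the shifted row from being cut off at the right end of row `j`. -/
theorem rowShift_comm {x : NilCone C} (hx : IsJordanFor b x) {i j : ℕ} {d : ℤ} (hd : 0 ≤ d)
    (hd' : (P.len i : ℤ) - d ≤ P.len j) (v : V) :
    rowShift b i j d (x.1 v) = x.1 (rowShift b i j d v) := by
  have : rowShift b i j d ∘ₗ x.1 = x.1 ∘ₗ rowShift b i j d := by
    refine b.ext fun p => ?_
    have hp := p.2.2
    rw [LinearMap.comp_apply, LinearMap.comp_apply, rowShift_basis, hx p,
      rowShift_extBasis hd (by omega)]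
    split_ifs with h
    · rw [h] at hp
      rw [apply_extBasis hx (by omega)]
      congr 1
      ring
    · rw [map_zero]
  exact LinearMap.congr_fun this v

theorem rowShift_mem (hP : P.signature = spaceSignature C) (hb : IsOfType C b) {i j : ℕ} {d : ℤ}
    (hc : P.color j + (((P.len j : ℤ) + d : ℤ) : ZMod n) = P.color i + (P.len i : ZMod n))
    {m : ZMod n} {v : V} (hv : v ∈ C m) : rowShift b i j d v ∈ C m := by
  refine map_mem_of_basis hP hb (fun p => ?_) hv
  rw [rowShift_basis]
  split_ifs with h
  · convert extBasis_mem hb j ((p.1.2 : ℤ) - d) using 2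
    rw [ColoredPartition.boxColor, h]
    push_cast at hc ⊢
    linear_combination -hc
  · exact zero_mem _

/-- The element `1 + φ` of `K`, where `φ` is a row shift. -/
theorem exists_one_add_rowShift (hP : P.signature = spaceSignature C) (hb : IsOfType C b)
    {x : NilCone C} (hx : IsJordanFor b x) {i j : ℕ} (hij : i ≠ j) {d : ℤ} (hd : 0 ≤ d)
    (hd' : (P.len i : ℤ) - d ≤ P.len j)
    (hc : P.color j + (((P.len j : ℤ) + d : ℤ) : ZMod n) = P.color i + (P.len i : ZMod n)) :
    ∃ g : colorGroup C, g • x = x ∧ ∀ v, g.1 v = v + rowShift b i j d v := by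
  let φ := rowShift b i j d
  have hφ : ∀ v, φ (φ v) = 0 := rowShift_rowShift hij hd hd'
  have hmem : ∀ {m v}, v ∈ C m → φ v ∈ C m := fun hv => rowShift_mem hP hb hc hv
  -- Since `φ` squares to zero, `1 - φ` inverts `1 + φ`.
  let g : V ≃ₗ[F] V := LinearEquiv.ofLinearMap (LinearMap.id + φ) (LinearMap.id - φ)
    (LinearMap.ext fun v => by simp [hφ]) (LinearMap.ext fun v => by simp [hφ])
  have hgv : ∀ v, g v = v + φ v := fun v => rfl
  have hg : g ∈ colorGroup C := fun m v => by
    refine ⟨fun h => ?_, fun h => ?_⟩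
    · have h2 : g v - φ (g v) = v := by simp [hgv, hφ]
      rw [← h2]
      exact sub_mem h (hmem h)
    · rw [hgv]
      exact add_mem h (hmem h)
  refine ⟨⟨g, hg⟩, conj_eq_iff_comm.mpr fun v => ?_, hgv⟩
  change g (x.1 v) = x.1 (g v)
  have hcomm := rowShift_comm hx hd hd' v
  rw [hgv, hgv, map_add]
  exact congrArg (x.1 v + ·) hcomm

/-- The marking obtained by deleting the mark in row `j`. -/
def ColoredPartition.Marking.erase (μ : P.Marking) (j : ℕ) : P.Marking :=
  ⟨Function.update μ.1 j 0, fun i => by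
    rcases eq_or_ne i j with rfl | h
    · simp
    · rw [Function.update_of_ne h]; exact μ.2 i⟩

theorem markedVector_erase (μ : P.Marking) (j : ℕ) :
    markedVector b (μ.erase j) + extBasis b j (μ j) = markedVector b μ := by
  have hterm : ∀ i, extBasis b i ((μ.erase j) i) =
      if i = j then 0 else extBasis b i (μ i) := by
    intro i
    split_ifs with h
    · subst h
      exact extBasis_of_nonpos (by simp [ColoredPartition.Marking.erase])
    · simp [ColoredPartition.Marking.erase, h]
  by_cases hj : j ∈ Finset.range P.length
  · rw [markedVector, markedVector, ← Finset.sum_erase_add _ _ hj,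
      ← Finset.sum_erase_add (f := fun i => extBasis b i (μ i)) _ hj, hterm j, if_pos rfl,
      add_zero]
    congr 1
    refine Finset.sum_congr rfl fun i hi => ?_
    rw [hterm, if_neg (Finset.ne_of_mem_erase hi)]
  · have h1 : extBasis b j (μ j) = 0 := by
      rw [Finset.mem_range, P.lt_length_iff] at hj
      refine extBasis_of_nonpos ?_
      have := μ.2 j
      omega
    rw [h1, add_zero]
    refine Finset.sum_congr rfl fun i hi => ?_
    rw [hterm, if_neg]
    rintro rfl
    exact hj hi

theorem rowShift_markedVector {i j : ℕ} {d : ℤ} (hd : 0 ≤ d) (μ : P.Marking) :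
    rowShift b i j d (markedVector b μ) =
      if i < P.length then extBasis b j (μ i - d) else 0 := by
  rw [markedVector, map_sum]
  simp only [rowShift_extBasis hd (μ.2 _), Finset.sum_ite_eq', Finset.mem_range]

end Spaces

/-! ### Markings with the same orbit -/

section Orbits

variable {n : ℕ} [NeZero n] {F V : Type*} [Field F] [AddCommGroup V] [Module F V]
  [FiniteDimensional F V] {C : ZMod n → Submodule F V} {P : ColoredPartition n}

/-- A mark dominated by another mark of the same color can be deleted. -/
theorem Psi_erase (hC : DirectSum.IsInternal C) (hP : P.signature = spaceSignature C)
    (μ : P.Marking) {i j : ℕ} (hij : i ≠ j) (hi : 0 < μ i) (hμ : μ j ≤ μ i)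
    (hlen : (P.len i : ℤ) - μ i ≤ (P.len j : ℤ) - μ j) (hc : P.markColor μ j = P.markColor μ i) :
    Psi hC P hP (μ.erase j) = Psi hC P hP μ := by
  obtain ⟨⟨b, x⟩, hb, hx⟩ := exists_typedJordan hC P hP
  -- This shift takes `v_{i,μ_i}` to `v_{j,μ_j}`. The two dominance inequalities and the equality of
  -- mark colors are exactly its requirements.
  obtain ⟨g, hgx, hg⟩ := exists_one_add_rowShift hP hb hx hij (d := μ i - μ j) (by omega)
    (by omega) (by
      simp only [ColoredPartition.markColor] at hc
      push_cast at hc ⊢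
      linear_combination hc)
  rw [Psi_eq hC hP _ hb hx, Psi_eq hC hP _ hb hx, eq_comm]
  refine Quotient.sound ⟨g, Prod.ext ?_ hgx⟩
  change g.1 (markedVector b (μ.erase j)) = markedVector b μ
  have hlt : i < P.length := (P.lt_length_iff i).mpr (by have := μ.2 i; omega)
  rw [hg, rowShift_markedVector (by omega), if_pos hlt, ← markedVector_erase μ j]
  congr 2
  simp [ColoredPartition.Marking.erase, hij]

/-- Two markings with the same orbit are related by the centralizer of `x` in `K`. -/
theorem exists_centralizer (hC : DirectSum.IsInternal C) (hP : P.signature = spaceSignature C)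
    {μ δ : P.Marking} (h : Psi hC P hP μ = Psi hC P hP δ) {b : Module.Basis P.Box F V}
    {x : NilCone C} (hb : IsOfType C b) (hx : IsJordanFor b x) :
    ∃ g : colorGroup C, g • x = x ∧ g.1 (markedVector b δ) = markedVector b μ := by
  rw [Psi_eq hC hP _ hb hx, Psi_eq hC hP _ hb hx] at h
  obtain ⟨g, hg⟩ := Quotient.exact h
  exact ⟨g, congrArg Prod.snd hg, congrArg Prod.fst hg⟩

end Orbits

/-! ### Uniqueness of the type of a colored Jordan basis -/

section Spaces

variable {n : ℕ} {F V : Type*} [Field F] [AddCommGroup V] [Module F V]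
variable {C : ZMod n → Submodule F V} {P : ColoredPartition n} {b : Module.Basis P.Box F V}

/-- `x ^ k` kills the basis vectors in the first `k` columns and moves the others injectively to
basis vectors. The left side does not involve the basis, so these box counts are invariants of `x`.
-/
theorem finrank_map_pow (hP : P.signature = spaceSignature C) (hb : IsOfType C b)
    {x : NilCone C} (hx : IsJordanFor b x) (k : ℕ) (m : ZMod n) :
    Module.finrank F ((C m).map (x.1 ^ k)) =
      {p : P.Box | k < p.1.2 ∧ P.boxColor p = m}.ncard := by
  classical
  let T := {p : P.Box // k < p.1.2 ∧ P.boxColor p = m}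
  have : Fintype T := Fintype.ofFinite _
  let s : T → P.Box := fun p => ⟨(p.1.1.1, p.1.1.2 - k), by
    have h1 := p.2.1
    have h2 := p.1.2.2
    dsimp only
    omega⟩
  have hs : Function.Injective s := by
    rintro ⟨⟨⟨i, j⟩, hp⟩, hk, hp'⟩ ⟨⟨⟨i', j'⟩, hq⟩, hk', hq'⟩ h
    simp only [s, Subtype.mk.injEq, Prod.mk.injEq] at h hk hk'
    obtain ⟨rfl, h⟩ := h
    obtain rfl : j = j' := by omega
    rfl
  have hxs : ∀ p : T, (x.1 ^ k) (b p.1) = b (s p) := by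
    intro p
    rw [pow_apply_extBasis hx, ← extBasis_eq b (s p)]
    congr 1
    have := p.2.1
    simp only [s]
    omega
  have hspan : (C m).map (x.1 ^ k) = Submodule.span F (Set.range (b ∘ s)) := by
    rw [← color_eq_span hP hb m, Submodule.map_span]
    apply le_antisymm
    · rw [Submodule.span_le]
      rintro _ ⟨_, ⟨⟨p, hp⟩, rfl⟩, rfl⟩
      by_cases hk : k < p.1.2
      · exact Submodule.subset_span ⟨⟨p, hk, hp⟩, (hxs ⟨p, hk, hp⟩).symm⟩
      · change (x.1 ^ k) (b p) ∈ _
        rw [pow_apply_extBasis hx, extBasis_of_nonpos (by omega)]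
        exact zero_mem _
    · rw [Submodule.span_le]
      rintro _ ⟨p, rfl⟩
      exact Submodule.subset_span ⟨b p.1, ⟨⟨p.1, p.2.2⟩, rfl⟩, hxs p⟩
  rw [hspan, finrank_span_eq_card (b.linearIndependent.comp s hs), ← Nat.card_eq_fintype_card]
  rfl

theorem extBasis_map (g : V ≃ₗ[F] V) (i : ℕ) (t : ℤ) :
    extBasis (b.map g) i t = g (extBasis b i t) := by
  rw [extBasis, extBasis]
  split_ifs
  · rw [Module.Basis.map_apply]
  · rw [map_zero]

theorem isOfType_map (hb : IsOfType C b) (g : colorGroup C) : IsOfType C (b.map g.1) := fun p => by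
  rw [Module.Basis.map_apply]
  exact (g.2 _ _).2 (hb p)

theorem isJordanFor_map {x : NilCone C} (hx : IsJordanFor b x) (g : colorGroup C) :
    IsJordanFor (b.map g.1) (g • x) := fun p => by
  rw [extBasis_map, Module.Basis.map_apply, ← hx p]
  change g.1 (x.1 (g.1.symm (g.1 (b p)))) = _
  rw [LinearEquiv.symm_apply_apply]

/-- The type of a colored Jordan basis is determined by `x` up to a permutation of the rows. -/
theorem exists_perm_of_isJordanFor {Q : ColoredPartition n} (hP : P.signature = spaceSignature C)
    (hQ : Q.signature = spaceSignature C) {b' : Module.Basis Q.Box F V} {x : NilCone C}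
    (hb : IsOfType C b) (hx : IsJordanFor b x) (hb' : IsOfType C b') (hx' : IsJordanFor b' x) :
    ∃ σ : Equiv.Perm ℕ, ∀ i, Q.len i = P.len (σ i) ∧ Q.color i = P.color (σ i) :=
  P.exists_perm_of_card_boxes_eq fun k m => by
    rw [← finrank_map_pow hP hb hx, ← finrank_map_pow hQ hb' hx']

/-- Summing over all rows lets a row permutation act by reindexing. -/
theorem markedVector_eq_finsum (b : Module.Basis P.Box F V) (μ : P.Marking) :
    markedVector b μ = ∑ᶠ i, extBasis b i (μ i) := by
  rw [markedVector, finsum_eq_sum_of_support_subset]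
  intro i hi
  rw [Finset.coe_range, Set.mem_Iio, P.lt_length_iff]
  by_contra h
  refine hi (extBasis_of_nonpos ?_)
  have := μ.2 i
  omega

/-- A permutation of the rows turns a colored Jordan basis of one type into one of the other. -/
theorem exists_isJordanFor_of_perm {Q : ColoredPartition n} {σ : Equiv.Perm ℕ}
    (hσ : ∀ i, Q.len i = P.len (σ i) ∧ Q.color i = P.color (σ i)) {b' : Module.Basis Q.Box F V}
    {x : NilCone C} (hb' : IsOfType C b') (hx' : IsJordanFor b' x) :
    ∃ b : Module.Basis P.Box F V, IsOfType C b ∧ IsJordanFor b x ∧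
      ∀ i t, extBasis b (σ i) t = extBasis b' i t := by
  let e : Q.Box ≃ P.Box := (σ.prodCongr (Equiv.refl ℕ)).subtypeEquiv fun p => by
    simp [(hσ p.1).1]
  have hext : ∀ i t, extBasis (b'.reindex e) (σ i) t = extBasis b' i t := by
    intro i t
    simp only [extBasis, (hσ i).1]
    split_ifs with h
    · rw [Module.Basis.reindex_apply]
      congr 1
      rw [Equiv.symm_apply_eq]
      rfl
    · rfl
  have hbe : ∀ q, b'.reindex e (e q) = b' q := fun q => by
    rw [Module.Basis.reindex_apply, Equiv.symm_apply_apply]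
  refine ⟨b'.reindex e, fun p => ?_, fun p => ?_, hext⟩
  · obtain ⟨q, rfl⟩ := e.surjective p
    have hcol : P.boxColor (e q) = Q.boxColor q := by
      change P.color (σ q.1.1) + (((P.len (σ q.1.1) : ℤ) - (q.1.2 : ℤ) : ℤ) : ZMod n) = _
      rw [← (hσ _).1, ← (hσ _).2]
      rfl
    rw [hbe, hcol]
    exact hb' q
  · obtain ⟨q, rfl⟩ := e.surjective p
    rw [hbe, hx' q]
    exact (hext _ _).symm

end Spaces

/-! ### Strictly nested markings -/

section Markings

variable {n : ℕ} {P : ColoredPartition n}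

/-- The marks of each color are strictly nested. -/
def IsStrictMarking (μ : P.Marking) : Prop :=
  ∀ i j : ℕ, i < j → 0 < μ i → 0 < μ j → P.markColor μ j = P.markColor μ i →
    μ j < μ i ∧ (P.len j : ℤ) - μ j < (P.len i : ℤ) - μ i

/-- Among positive marks of one color, `μ` and `λ - μ` decrease together down the rows, so no mark
dominates another: the first inequality excludes `i < j`, the second `j < i`. -/
theorem IsStrictMarking.eq_of_le {μ : P.Marking} (h : IsStrictMarking μ) {i j : ℕ} (hi : 0 < μ i)
    (hc : P.markColor μ j = P.markColor μ i) (hle : μ i ≤ μ j)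
    (hle' : (P.len j : ℤ) - μ j ≤ (P.len i : ℤ) - μ i) : i = j := by
  rcases lt_trichotomy i j with hij | hij | hij
  · have := h i j hij hi (by omega) hc
    omega
  · exact hij
  · have := h j i hij (by omega) hi hc.symm
    omega

theorem IsStrictMarking.eq_of_row_eq {μ : P.Marking} (h : IsStrictMarking μ) {i j : ℕ}
    (hlen : P.len i = P.len j) (hcol : P.color i = P.color j) (hi : 0 < μ i) (hij : μ i = μ j) :
    i = j :=
  h.eq_of_le hi (by simp only [ColoredPartition.markColor, hlen, hcol, hij]) hij.le (by omega)

theorem ColoredPartition.Marking.support_subset {μ : P.Marking} (h : ∀ i, 0 ≤ μ i) :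
    Function.support (fun i => μ i) ⊆ (Finset.range P.length : Set ℕ) := by
  intro i hi
  rw [Finset.coe_range, Set.mem_Iio, P.lt_length_iff]
  have h1 := μ.2 i
  have h2 := h i
  have h3 : μ i ≠ 0 := hi
  omega

/-- Nonnegative markings `δ ≤ μ` with the same total are equal. -/
theorem eq_of_le_of_finsum_eq {μ δ : P.Marking} (hμ : ∀ i, 0 ≤ μ i) (hδ : ∀ i, 0 ≤ δ i)
    (hle : δ ≤ μ) (h : ∑ᶠ i, δ i = ∑ᶠ i, μ i) : δ = μ := by
  have hμs := ColoredPartition.Marking.support_subset hμ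
  have hδs := ColoredPartition.Marking.support_subset hδ
  rw [finsum_eq_sum_of_support_subset _ hμs, finsum_eq_sum_of_support_subset _ hδs,
    Finset.sum_eq_sum_iff_of_le fun i _ => hle i] at h
  refine Subtype.ext (funext fun i => ?_)
  by_cases hi : i ∈ Finset.range P.length
  · exact h i hi
  · have h1 : μ i = 0 := by_contra fun h0 => hi (hμs h0)
    have h2 : δ i = 0 := by_contra fun h0 => hi (hδs h0)
    exact h2.trans h1.symm

end Markings

/-! ### Minimal markings of an orbit -/

section Orbits

variable {n : ℕ} [NeZero n] {F V : Type*} [Field F] [AddCommGroup V] [Module F V]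
  [FiniteDimensional F V] {C : ZMod n → Submodule F V} {P : ColoredPartition n}

/-- The orbit may be presented by another colored partition `Q`. Equality of nilpotent orbits gives
one element with Jordan bases of both types, so `Q` is a row permutation of `P` and its marking can
be carried over. -/
theorem markingsOf_nonempty (hC : DirectSum.IsInternal C) (hP : P.signature = spaceSignature C)
    {O : EnhOrbit C} (hO : O ∈ psiImage hC) (hPO : projOrbit O = shapeOrbit hC P hP) :
    (markingsOf hC P hP O).Nonempty := by
  obtain ⟨Q, hQ, γ, rfl⟩ := hO
  obtain ⟨⟨b, x⟩, hb, hx⟩ := exists_typedJordan hC P hP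
  obtain ⟨⟨b', x'⟩, hb', hx'⟩ := exists_typedJordan hC Q hQ
  dsimp only at hb hx hb' hx'
  rw [Psi_eq hC hQ γ hb' hx', shapeOrbit_eq hC hP hb hx] at hPO
  obtain ⟨g, hg⟩ := Quotient.exact hPO
  have hg : g • x = x' := hg
  obtain ⟨σ, hσ⟩ := exists_perm_of_isJordanFor hP hQ (isOfType_map hb g)
    (hg ▸ isJordanFor_map hx g) hb' hx'
  obtain ⟨c, hc, hcx, hext⟩ := exists_isJordanFor_of_perm hσ hb' hx'
  -- Replacing negative marks by `0` leaves the vector unchanged, as both contribute zero.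
  let μ : P.Marking := ⟨fun i => max (γ (σ.symm i)) 0, fun i => by
    have h1 := γ.2 (σ.symm i)
    rw [(hσ _).1, Equiv.apply_symm_apply] at h1
    exact max_le h1 (by positivity)⟩
  refine ⟨μ, ?_, fun i => le_max_right _ _⟩
  rw [Psi_eq hC hP μ hc hcx, Psi_eq hC hQ γ hb' hx', markedVector_eq_finsum,
    markedVector_eq_finsum, ← finsum_comp_equiv σ]
  congr 1
  refine finsum_congr fun i => ?_
  rw [hext]
  have hμ : μ (σ i) = max (γ i) 0 := by simp [μ]
  rw [hμ]
  rcases le_total (γ i) 0 with h | h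
  · rw [max_eq_right h, extBasis_of_nonpos le_rfl, extBasis_of_nonpos h]
  · rw [max_eq_left h]

/-- A dominated positive mark could be erased, giving a smaller marking of the same orbit. -/
theorem IsMinimalMarking.isStrictMarking {hC : DirectSum.IsInternal C}
    {hP : P.signature = spaceSignature C} {O : EnhOrbit C} {μ : P.Marking}
    (h : IsMinimalMarking hC P hP O μ) : IsStrictMarking μ := by
  have key : ∀ i j, i ≠ j → 0 < μ i → 0 < μ j → P.markColor μ j = P.markColor μ i →
      μ j ≤ μ i → (P.len j : ℤ) - μ j < (P.len i : ℤ) - μ i := by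
    intro i j hij hi hj hc hle
    by_contra! hlen
    have hval : ∀ k, (μ.erase j) k = if k = j then 0 else μ k := fun k => by
      simp [ColoredPartition.Marking.erase, Function.update_apply]
    have heq := h.2 (μ.erase j) ⟨(Psi_erase hC hP μ hij hi hle hlen hc).trans h.1.1, fun k => by
      rw [hval]
      split_ifs
      · exact le_rfl
      · exact h.1.2 k⟩ (fun k => by
      change (μ.erase j) k ≤ μ k
      rw [hval]
      split_ifs
      · exact h.1.2 k
      · exact le_rfl)
    have h0 := hval j
    rw [heq, if_pos rfl] at h0
    omega
  intro i j hij hi hj hc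
  have hlen : P.len j ≤ P.len i := P.len_antitone hij.le
  have hlt : μ j < μ i := by
    -- If `μ i ≤ μ j`, the monotonicity of row lengths makes row `j` dominate row `i`, against `key`
    -- with the roles exchanged.
    by_contra! hle
    have := key j i hij.ne' hj hi hc.symm hle
    omega
  exact ⟨hlt, key i j hij.ne hi hj hc hlt.le⟩

/-- Dominate the mark in row `i` by one of `δ` in row `j`, and that one by a mark of `μ` in row `k`.
Strictness of `μ` gives `k = i`, so the chains `μ_i ≤ δ_j ≤ μ_k` and `λ_k - μ_k ≤ λ_j - δ_j ≤ λ_i -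
μ_i` collapse to equalities. -/
theorem IsStrictMarking.exists_row_eq {hC : DirectSum.IsInternal C}
    {hP : P.signature = spaceSignature C} {μ δ : P.Marking} (hμ : IsStrictMarking μ)
    (h : Psi hC P hP μ = Psi hC P hP δ) {i : ℕ} (hi : 0 < μ i) :
    ∃ j, P.len j = P.len i ∧ P.color j = P.color i ∧ δ j = μ i := by
  obtain ⟨⟨b, x⟩, hb, hx⟩ := exists_typedJordan hC P hP
  obtain ⟨g, hgx, hg⟩ := exists_centralizer hC hP h hb hx
  obtain ⟨g', hgx', hg'⟩ := exists_centralizer hC hP h.symm hb hx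
  obtain ⟨j, hc, hle, hlen⟩ := exists_mark_dominating hP hb hx hgx hg hi
  obtain ⟨k, hc', hle', hlen'⟩ :=
    exists_mark_dominating hP hb hx hgx' hg' (i := j) (by omega)
  obtain rfl := hμ.eq_of_le hi (hc'.trans hc) (by omega) (by omega)
  have hδ : δ j = μ i := by omega
  have hl : P.len j = P.len i := by omega
  refine ⟨j, hl, ?_, hδ⟩
  simpa only [ColoredPartition.markColor, hl, hδ, add_left_inj] using hc

theorem IsStrictMarking.rowEquivalent {hC : DirectSum.IsInternal C}
    {hP : P.signature = spaceSignature C} {O : EnhOrbit C} {μ δ : P.Marking}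
    (hμ : IsStrictMarking μ) (hδ : IsStrictMarking δ) (hμO : μ ∈ markingsOf hC P hP O)
    (hδO : δ ∈ markingsOf hC P hP O) : RowEquivalent P P μ δ :=
  P.rowEquivalent_of_forall_exists hμO.2 hδO.2 (fun _ _ => hμ.eq_of_row_eq)
    (fun _ _ => hδ.eq_of_row_eq)
    (fun _ => hμ.exists_row_eq (hμO.1.trans hδO.1.symm))
    (fun _ => hδ.exists_row_eq (hδO.1.trans hμO.1.symm))

theorem exists_isMinimalMarking_le {hC : DirectSum.IsInternal C}
    {hP : P.signature = spaceSignature C} {O : EnhOrbit C} {μ : P.Marking}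
    (hμ : μ ∈ markingsOf hC P hP O) : ∃ δ ≤ μ, IsMinimalMarking hC P hP O δ := by
  -- Nonnegative markings vanish on empty rows, so they are determined by finitely many bounded
  -- integers.
  have hfin : (markingsOf hC P hP O).Finite := by
    have hbox : (Set.univ.pi fun i : Fin P.length => Set.Icc (0 : ℤ) (P.len i)).Finite :=
      Set.Finite.pi fun i => Set.finite_Icc _ _
    refine Set.Finite.of_finite_image (f := fun (ν : P.Marking) (i : Fin P.length) => ν i)
      (hbox.subset ?_) ?_
    · rintro _ ⟨ν, hν, rfl⟩ i -
      exact ⟨hν.2 i, ν.2 i⟩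
    · intro ν hν ν' hν' h
      refine Subtype.ext (funext fun i => ?_)
      by_cases hi : i < P.length
      · exact congrFun h ⟨i, hi⟩
      · have h1 : ν i = 0 := by_contra fun h0 =>
          hi (Finset.mem_range.mp (ColoredPartition.Marking.support_subset hν.2 h0))
        have h2 : ν' i = 0 := by_contra fun h0 =>
          hi (Finset.mem_range.mp (ColoredPartition.Marking.support_subset hν'.2 h0))
        exact h1.trans h2.symm
  obtain ⟨δ, hle, hδ⟩ := hfin.exists_le_minimal hμ
  exact ⟨δ, hle, hδ.1, fun ν hν h => le_antisymm h (hδ.2 hν h)⟩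

/-- Below any competitor `δ ≤ μ` lies a minimal, hence strict, marking `ν`. It is row-equivalent to
`μ`, so the totals agree, and `ν ≤ δ ≤ μ` collapses. -/
theorem IsStrictMarking.isMinimalMarking {hC : DirectSum.IsInternal C}
    {hP : P.signature = spaceSignature C} {O : EnhOrbit C} {μ : P.Marking}
    (hμ : IsStrictMarking μ) (hμO : μ ∈ markingsOf hC P hP O) :
    IsMinimalMarking hC P hP O μ := by
  refine ⟨hμO, fun δ hδ hle => ?_⟩
  obtain ⟨ν, hνδ, hν⟩ := exists_isMinimalMarking_le hδ
  obtain ⟨σ, hσ⟩ := hμ.rowEquivalent hν.isStrictMarking hμO hν.1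
  have hsum : ∑ᶠ i, ν i = ∑ᶠ i, μ i := by
    rw [← finsum_comp_equiv σ (f := fun i => μ i)]
    exact finsum_congr fun i => (hσ i).2.2
  have heq := eq_of_le_of_finsum_eq hμO.2 hν.1.2 (hνδ.trans hle) hsum
  exact le_antisymm hle (heq ▸ hνδ)

end Orbits

end ColoredCone

open ColoredCone in
theorem mainTheorem8 {n : ℕ} [NeZero n] {F V : Type*} [Field F] [AddCommGroup V] [Module F V]
    [FiniteDimensional F V] (C : ZMod n → Submodule F V) (hC : DirectSum.IsInternal C)
    (O : EnhOrbit C) (hO : O ∈ psiImage hC)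
    (P : ColoredPartition n) (hP : P.signature = spaceSignature C)
    (hPO : projOrbit O = shapeOrbit hC P hP) :
    (∃ μ : P.Marking, IsMinimalMarking hC P hP O μ) ∧
    (∀ μ ∈ markingsOf hC P hP O, ∃ δ ≤ μ, IsMinimalMarking hC P hP O δ) ∧
    (∀ μ δ : P.Marking, IsMinimalMarking hC P hP O μ → IsMinimalMarking hC P hP O δ →
      RowEquivalent P P μ δ) ∧
    (∀ μ ∈ markingsOf hC P hP O,
      (IsMinimalMarking hC P hP O μ ↔
        ∀ i j : ℕ, i < j → 0 < μ i → 0 < μ j → P.markColor μ j = P.markColor μ i →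
          μ j < μ i ∧ (P.len j : ℤ) - μ j < (P.len i : ℤ) - μ i)) := by
  obtain ⟨μ₀, hμ₀⟩ := markingsOf_nonempty hC hP hO hPO
  refine ⟨?_, fun μ hμ => exists_isMinimalMarking_le hμ,
    fun μ δ hμ hδ => hμ.isStrictMarking.rowEquivalent hδ.isStrictMarking hμ.1 hδ.1,
    fun μ hμ => ⟨fun h => h.isStrictMarking, fun h => IsStrictMarking.isMinimalMarking h hμ⟩⟩
  obtain ⟨δ, -, hδ⟩ := exists_isMinimalMarking_le hμ₀
  exact ⟨δ, hδ⟩
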